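/- Let $\mathbb{R}^+=[0,\infty)$. An $N$-function is a differentiable convex function $\Phi:\mathbb{R}^+\to\mathbb{R}^+$ with $\lim_{t\to+\infty}\Phi(t)/t=+\infty$ and $\lim_{t\to0}\Phi(t)/t=0$. Its complementary function is $\Psi(s)=\int_0^s\psi(r)\,dr$, where $\psi$ is the inverse of $\varphi=\Phi'$ (the right-continuous inverse $\psi(r)=\sup\{t\ge 0:\varphi(t)\le r\}$ if $\varphi$ is not injective). For functions $\Phi_1,\Phi_2$ on $\mathbb{R}^+$ write $\Phi_1\prec\Phi_2$ if there are $a>0$ and $x_0\ge0$ with $\Phi_1(x)\le\Phi_2(ax)$ for all $x\ge x_0$, and $\Phi_1\lll\Phi_2$ if for every $a>0$ there is $x_0\ge0$ with $\Phi_1(x)\le\Phi_2(ax)$ for all $x\ge x_0$. Write $\Psi\in\Delta_2^\infty$ if there are $K>0$, $x_0\ge0$ with $\Psi(2x)\le K\Psi(x)$ for all $x\ge x_0$. Fix $T>0$ and an integer $d\ge1$. For measurable $u:[0,T]\to\mathbb{R}^d$ put $\rho_\Phi(u)=\int_0^T\Phi(|u|)\,dt\in[0,\infty]$, where $|\cdot|$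 is the Euclidean norm, let $L^\Phi$ be the set of measurable $u$ with $\rho_\Phi(\lambda u)<\infty$ for some $\lambda>0$, and for $u\in L^\Phi$ let $\|u\|_{L^\Phi}=\sup\{\int_0^T u\cdot v\,dt : v:[0,T]\to\mathbb{R}^d \text{ measurable},\ \rho_\Psi(v)\le1\}$. Let $\Phi$ be an $N$-function with complementary function $\Psi$. If $\Psi\in\Delta_2^\infty$, then there is an $N$-function $\Phi^*\prec\Phi$ such that for every $N$-function $\Phi_0\lll\Phi^*$ and every $k>0$, $$\lim_{\substack{u\in L^\Phi\\ \|u\|_{L^\Phi}\to\infty}}\frac{\int_0^T\Phi(|u|)\,dt}{\Phi_0(k\|u\|_{L^\Phi})}=\infty.\qquad(*)$$ Conversely, if $(*)$ holds for some $N$-function $\Phi_0$ and some $k>0$, then $\Psi\in\Delta_2^\infty$. -/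

import Mathlib

open MeasureTheory Filter Topology

namespace Orlicz

/-- A (differentiable) N-function: a function on the nonnegative half line. Functions on `[0, ∞)` are
represented by functions on `ℝ` of which only the values on `Set.Ici 0` are ever used. -/
structure IsNFunction (Φ : ℝ → ℝ) : Prop where
  nonneg : ∀ x, 0 ≤ x → 0 ≤ Φ x
  convex : ConvexOn ℝ (Set.Ici 0) Φ
  tendsto_top : Tendsto (fun t => Φ t / t) atTop atTop
  tendsto_zero : Tendsto (fun t => Φ t / t) (𝓝[>] 0) (𝓝 0)
  differentiable : DifferentiableOn ℝ Φ (Set.Ici 0)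

/-- The derivative `φ` of `Φ` on `[0, ∞)` (one-sided at `0`). -/
noncomputable def density (Φ : ℝ → ℝ) (t : ℝ) : ℝ := derivWithin Φ (Set.Ici 0) t

/-- The inverse `ψ` of the derivative `φ` of `Φ`. For an N-function, `φ` is continuous, nondecreasing and
maps `[0, ∞)` onto `[0, ∞)`; if `φ` is strictly increasing, this is its inverse bijection, and
otherwise it is the usual right-continuous inverse. -/
noncomputable def inverseDensity (Φ : ℝ → ℝ) (s : ℝ) : ℝ :=
  sSup {t : ℝ | 0 ≤ t ∧ density Φ t ≤ s}

/-- The complementary function `Ψ` of `Φ`: the primitive of `ψ` that vanishes at `0`. -/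
noncomputable def complementary (Φ : ℝ → ℝ) (s : ℝ) : ℝ :=
  ∫ r in (0 : ℝ)..s, inverseDensity Φ r

/-- `Φ₁ ≺ Φ₂`: `Φ₂` is stronger than `Φ₁`. -/
def Prec (Φ₁ Φ₂ : ℝ → ℝ) : Prop :=
  ∃ a : ℝ, 0 < a ∧ ∃ x₀ : ℝ, 0 ≤ x₀ ∧ ∀ x, x₀ ≤ x → Φ₁ x ≤ Φ₂ (a * x)

/-- `Φ₁ ⋘ Φ₂`: `Φ₂` is essentially stronger than `Φ₁`. -/
def EssPrec (Φ₁ Φ₂ : ℝ → ℝ) : Prop :=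
  ∀ a : ℝ, 0 < a → ∃ x₀ : ℝ, 0 ≤ x₀ ∧ ∀ x, x₀ ≤ x → Φ₁ x ≤ Φ₂ (a * x)

/-- The `Δ₂` condition at infinity. -/
def DeltaTwoInfty (η : ℝ → ℝ) : Prop :=
  ∃ K : ℝ, 0 < K ∧ ∃ x₀ : ℝ, 0 ≤ x₀ ∧ ∀ x, x₀ ≤ x → η (2 * x) ≤ K * η x

/-- Lebesgue measure on `[0, T]`. -/
noncomputable def leb (T : ℝ) : Measure ℝ := volume.restrict (Set.Icc 0 T)

/-- The modular `ρ_Φ(u) = ∫₀ᵀ Φ(|u|) dt ∈ [0, ∞]`, with the Euclidean norm on `ℝᵈ`. -/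
noncomputable def modular {d : ℕ} (T : ℝ) (Φ : ℝ → ℝ) (u : ℝ → EuclideanSpace ℝ (Fin d)) : ENNReal :=
  ∫⁻ t, ENNReal.ofReal (Φ ‖u t‖) ∂(leb T)

/-- The Orlicz space `L^Φ([0, T], ℝᵈ)`, as a set of (Lebesgue) measurable functions. -/
def orliczSpace (d : ℕ) (T : ℝ) (Φ : ℝ → ℝ) : Set (ℝ → EuclideanSpace ℝ (Fin d)) :=
  {u | AEMeasurable u (leb T) ∧ ∃ c : ℝ, 0 < c ∧ modular T Φ (fun t => c • u t) < ⊤}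

/-- The Orlicz norm `‖u‖ = sup {∫₀ᵀ u · v dt | ρ_Ψ(v) ≤ 1}`, with `Ψ` complementary to `Φ`. By Young's
inequality, for `u` in the Orlicz space all these integrals exist and are bounded above. -/
noncomputable def orliczNorm {d : ℕ} (T : ℝ) (Φ : ℝ → ℝ) (u : ℝ → EuclideanSpace ℝ (Fin d)) : ℝ :=
  sSup {x : ℝ | ∃ v : ℝ → EuclideanSpace ℝ (Fin d), AEMeasurable v (leb T) ∧
    modular T (complementary Φ) v ≤ 1 ∧ x = ∫ t, inner ℝ (u t) (v t) ∂(leb T)}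

/-- `ρ_Φ(u) / Φ₀(k ‖u‖) → ∞` as `‖u‖ → ∞`, `u ∈ L^Φ([0, T], ℝᵈ)`. -/
def Coercive (d : ℕ) (T : ℝ) (Φ Φ₀ : ℝ → ℝ) (k : ℝ) : Prop :=
  Tendsto (fun u : ℝ → EuclideanSpace ℝ (Fin d) =>
      modular T Φ u / ENNReal.ofReal (Φ₀ (k * orliczNorm T Φ u)))
    (comap (orliczNorm T Φ) atTop ⊓ 𝓟 (orliczSpace d T Φ)) (𝓝 ⊤)

end Orlicz

/-!
Let `φ = Φ'`, with inverse `ψ`. The Legendre transform `s ψ(s) - Φ(ψ(s))` has `ψ(s)` as a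
subgradient at `s`, so it is the primitive `Ψ` of `ψ`; this gives Young's inequality
`x y ≤ Φ(x) + Ψ(y)`, with equality at `y = φ(x)`.

If `Ψ(2y) ≤ 2l Ψ(y)` for large `y`, then comparing Young's inequality at `(l x, 2 φ(x))` with the
equality at `(x, φ(x))` gives `2l Φ(x) ≤ Φ(l x)`. Iterating, `Φ(r x) ≥ c r ^ p Φ(x)` with
`p = log_l (2l) > 1`. Inserted into `‖u‖ ≤ r (ρ_Φ(u / r) + 1)` with `r` proportional to `‖u‖`, this
yields `ρ_Φ(u) ≥ b ‖u‖ ^ p` for large `‖u‖`, and `Φ*(x) = x ^ p` works.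

Conversely, coercivity gives `ρ_Φ(u) ≥ 2 ‖u‖` once `‖u‖ ≥ R`. A function `u` equal to
`x = R Ψ(y) / y` on a set of measure `1 / Ψ(y)` and zero elsewhere has norm at least `R`, hence
`Φ(x) ≥ 2 x y`. Thus `φ(x) ≥ 2y`, i.e. `ψ ≤ x` below `2y`, and `Ψ(2y) ≤ 2 x y = 2R Ψ(y)`.
-/

namespace Orlicz

open Set

section Subgradient

variable {G g : ℝ → ℝ}

/-- `g a` is a subgradient of `G` at every point `a` of the line. It encodes the
subdifferential of `G` through a selection, for which the fundamental theorem of calculus holds. -/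
def IsSubgradientSelection (G g : ℝ → ℝ) : Prop :=
  ∀ a b, G a + g a * (b - a) ≤ G b

namespace IsSubgradientSelection

theorem monotone (h : IsSubgradientSelection G g) : Monotone g := by
  intro a b hab
  by_contra! hlt
  have hne : a ≠ b := by rintro rfl; exact hlt.false
  have hpos : 0 < (g a - g b) * (b - a) :=
    mul_pos (sub_pos.2 hlt) (sub_pos.2 (hab.lt_of_ne hne))
  linarith [h a b, h b a]

theorem convexOn (h : IsSubgradientSelection G g) : ConvexOn ℝ univ G := by
  refine ⟨convex_univ, fun x _ y _ a b ha hb hab => ?_⟩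
  simp only [smul_eq_mul]
  set z := a * x + b * y
  obtain rfl : b = 1 - a := by linarith
  have hx := mul_le_mul_of_nonneg_left (h z x) ha
  have hy := mul_le_mul_of_nonneg_left (h z y) hb
  linarith [show g z * (a * x + (1 - a) * y - z) = 0 by simp [z]]

theorem continuous (h : IsSubgradientSelection G g) : Continuous G :=
  continuousOn_univ.1 (h.convexOn.continuousOn isOpen_univ)

theorem hasDerivAt (h : IsSubgradientSelection G g) {x : ℝ} (hx : ContinuousAt g x) :
    HasDerivAt G (g x) x := by
  rw [hasDerivAt_iff_isLittleO, Asymptotics.isLittleO_iff]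
  intro ε hε
  filter_upwards [Metric.continuousAt_iff'.1 hx ε hε] with y hy
  have hlower : 0 ≤ G y - G x - (y - x) * g x := by linarith [h x y]
  have hupper : G y - G x - (y - x) * g x ≤ (g y - g x) * (y - x) := by linarith [h y x]
  rw [smul_eq_mul, Real.norm_of_nonneg hlower]
  refine hupper.trans ((le_abs_self _).trans ?_)
  rw [abs_mul]
  gcongr
  · exact hy.le
  · rfl

theorem integral_eq_sub (h : IsSubgradientSelection G g) (a b : ℝ) :
    ∫ x in a..b, g x = G b - G a :=
  integral_eq_of_hasDerivAt_off_countable G g h.monotone.countable_not_continuousAt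
    h.continuous.continuousOn (fun _ hx => h.hasDerivAt (not_not.1 hx.2))
    h.monotone.intervalIntegrable

end IsSubgradientSelection

end Subgradient

variable {Φ Φ₀ : ℝ → ℝ} {p : ℝ}

theorem density_eq_deriv {x : ℝ} (hx : 0 < x) : density Φ x = deriv Φ x :=
  derivWithin_of_mem_nhds (Ici_mem_nhds hx)

theorem inverseDensity_nonneg (s : ℝ) : 0 ≤ inverseDensity Φ s :=
  Real.sSup_nonneg fun _ ht => ht.1

theorem complementary_zero : complementary Φ 0 = 0 :=
  intervalIntegral.integral_same

namespace IsNFunction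

theorem continuousOn (h : IsNFunction Φ) : ContinuousOn Φ (Ici 0) :=
  h.differentiable.continuousOn

theorem map_zero (h : IsNFunction Φ) : Φ 0 = 0 := by
  have hΦ : Tendsto Φ (𝓝[>] 0) (𝓝 (Φ 0)) :=
    (h.continuousOn 0 self_mem_Ici).mono Ioi_subset_Ici_self
  have hmul : Tendsto (fun t => Φ t / t * t) (𝓝[>] 0) (𝓝 (0 * 0)) :=
    h.tendsto_zero.mul (tendsto_id.mono_left nhdsWithin_le_nhds)
  rw [zero_mul] at hmul
  refine tendsto_nhds_unique hΦ (hmul.congr' ?_)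
  filter_upwards [self_mem_nhdsWithin] with t ht
  exact div_mul_cancel₀ _ (ne_of_gt ht)

theorem tendsto_atTop (h : IsNFunction Φ) : Tendsto Φ atTop atTop := by
  refine tendsto_atTop_mono' _ ?_ h.tendsto_top
  filter_upwards [eventually_ge_atTop 1] with x hx
  exact div_le_self (h.nonneg x (by linarith)) hx

theorem eventually_mul_le (h : IsNFunction Φ) (c : ℝ) : ∀ᶠ x in atTop, c * x ≤ Φ x := by
  filter_upwards [h.tendsto_top.eventually_ge_atTop c, eventually_gt_atTop 0] with x hx hx0
  exact (le_div_iff₀ hx0).1 hx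

theorem density_zero (h : IsNFunction Φ) : density Φ 0 = 0 := by
  have hslope := (h.differentiable 0 self_mem_Ici).hasDerivWithinAt
  rw [hasDerivWithinAt_iff_tendsto_slope, Ici_sdiff_left] at hslope
  refine tendsto_nhds_unique hslope (h.tendsto_zero.congr fun t => ?_)
  simp only [slope_def_field, h.map_zero, sub_zero]

theorem add_density_mul_sub_le (h : IsNFunction Φ) {x t : ℝ} (hx : 0 ≤ x) (ht : 0 ≤ t) :
    Φ x + density Φ x * (t - x) ≤ Φ t := by
  rcases lt_trichotomy x t with hxt | rfl | hxt
  · have hslope := h.convex.derivWithin_le_slope hx ht hxt (h.differentiable x hx)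
    rw [slope_def_field, le_div_iff₀ (sub_pos.2 hxt)] at hslope
    rw [density]; linarith
  · simp
  · have hslope := h.convex.slope_le_derivWithin ht hx hxt (h.differentiable x hx)
    rw [slope_def_field, div_le_iff₀ (sub_pos.2 hxt)] at hslope
    rw [density]; linarith

theorem density_monotoneOn (h : IsNFunction Φ) : MonotoneOn (density Φ) (Ici 0) :=
  h.convex.monotoneOn_derivWithin h.differentiable

theorem density_nonneg (h : IsNFunction Φ) {x : ℝ} (hx : 0 ≤ x) : 0 ≤ density Φ x :=
  h.density_zero.ge.trans (h.density_monotoneOn self_mem_Ici hx hx)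

theorem monotoneOn (h : IsNFunction Φ) : MonotoneOn Φ (Ici 0) := by
  intro x hx y hy hxy
  have hslope := mul_nonneg (h.density_nonneg hx) (sub_nonneg.2 hxy)
  linarith [h.add_density_mul_sub_le hx hy]

theorem le_density_of_mul_le (h : IsNFunction Φ) {x c : ℝ} (hx : 0 < x) (hc : c * x ≤ Φ x) :
    c ≤ density Φ x := by
  have htangent := h.add_density_mul_sub_le hx.le le_rfl
  rw [h.map_zero] at htangent
  exact le_of_mul_le_mul_right (by linarith) hx

theorem tendsto_density (h : IsNFunction Φ) : Tendsto (density Φ) atTop atTop := by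
  refine Filter.tendsto_atTop.2 fun c => ?_
  filter_upwards [h.eventually_mul_le c, eventually_gt_atTop 0] with x hx hx0
  exact h.le_density_of_mul_le hx0 hx

theorem inverseDensity_le (h : IsNFunction Φ) {s t : ℝ} (ht : 0 ≤ t) (hts : s < density Φ t) :
    inverseDensity Φ s ≤ t := by
  refine Real.sSup_le (fun r ⟨hr, hrs⟩ => ?_) ht
  by_contra! htr
  linarith [h.density_monotoneOn ht hr htr.le]

theorem le_inverseDensity (h : IsNFunction Φ) {s t : ℝ} (ht : 0 ≤ t) (hts : density Φ t ≤ s) :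
    t ≤ inverseDensity Φ s := by
  obtain ⟨x, hx, hx0⟩ :=
    ((h.tendsto_density.eventually_gt_atTop s).and (eventually_ge_atTop 0)).exists
  refine le_csSup ⟨x, fun r ⟨hr, hrs⟩ => ?_⟩ ⟨ht, hts⟩
  by_contra! hxr
  linarith [h.density_monotoneOn hx0 hr hxr.le]

theorem add_mul_sub_inverseDensity_le (h : IsNFunction Φ) (s : ℝ) {t : ℝ} (ht : 0 ≤ t) :
    Φ (inverseDensity Φ s) + s * (t - inverseDensity Φ s) ≤ Φ t := by
  set m := inverseDensity Φ s
  have hm0 : 0 ≤ m := inverseDensity_nonneg s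
  have hdiff {a b : ℝ} (ha : 0 ≤ a) : DifferentiableOn ℝ Φ (interior (Icc a b)) :=
    h.differentiable.mono (interior_subset.trans fun x hx => ha.trans hx.1)
  have hcont {a b : ℝ} (ha : 0 ≤ a) : ContinuousOn Φ (Icc a b) :=
    h.continuousOn.mono fun x hx => ha.trans hx.1
  rcases le_total t m with htm | hmt
  · have hderiv : ∀ c ∈ interior (Icc t m), deriv Φ c ≤ s := by
      rw [interior_Icc]
      rintro c ⟨htc, hcm⟩
      rw [← density_eq_deriv (ht.trans_lt htc)]
      exact not_lt.1 fun hlt => (h.inverseDensity_le (ht.trans htc.le) hlt).not_gt hcm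
    linarith [(convex_Icc t m).image_sub_le_mul_sub_of_deriv_le (hcont ht) (hdiff ht) hderiv
      t (left_mem_Icc.2 htm) m (right_mem_Icc.2 htm) htm]
  · have hderiv : ∀ c ∈ interior (Icc m t), s ≤ deriv Φ c := by
      rw [interior_Icc]
      rintro c ⟨hmc, -⟩
      rw [← density_eq_deriv (hm0.trans_lt hmc)]
      exact not_lt.1 fun hlt => (h.le_inverseDensity (hm0.trans hmc.le) hlt.le).not_gt hmc
    linarith [(convex_Icc m t).mul_sub_le_image_sub_of_le_deriv (hcont hm0) (hdiff hm0) hderiv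
      m (left_mem_Icc.2 hmt) t (right_mem_Icc.2 hmt) hmt]

theorem isSubgradientSelection_inverseDensity (h : IsNFunction Φ) :
    IsSubgradientSelection (fun s => s * inverseDensity Φ s - Φ (inverseDensity Φ s))
      (inverseDensity Φ) := by
  intro a b
  linarith [h.add_mul_sub_inverseDensity_le b (inverseDensity_nonneg (Φ := Φ) a)]

theorem complementary_eq (h : IsNFunction Φ) (s : ℝ) :
    complementary Φ s = s * inverseDensity Φ s - Φ (inverseDensity Φ s) := by
  have hzero : Φ (inverseDensity Φ 0) = 0 := by
    refine le_antisymm ?_ (h.nonneg _ (inverseDensity_nonneg 0))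
    simpa [h.map_zero] using h.add_mul_sub_inverseDensity_le 0 le_rfl
  rw [complementary, h.isSubgradientSelection_inverseDensity.integral_eq_sub, hzero]
  ring

theorem mul_le_add_complementary (h : IsNFunction Φ) {x : ℝ} (hx : 0 ≤ x) (y : ℝ) :
    x * y ≤ Φ x + complementary Φ y := by
  rw [h.complementary_eq]
  linarith [h.add_mul_sub_inverseDensity_le y hx]

theorem add_complementary_density (h : IsNFunction Φ) {x : ℝ} (hx : 0 ≤ x) :
    Φ x + complementary Φ (density Φ x) = x * density Φ x := by
  refine le_antisymm ?_ (h.mul_le_add_complementary hx _)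
  rw [h.complementary_eq]
  linarith [h.add_density_mul_sub_le hx (inverseDensity_nonneg (Φ := Φ) (density Φ x))]

theorem complementary_nonneg (h : IsNFunction Φ) (y : ℝ) : 0 ≤ complementary Φ y := by
  simpa [h.map_zero] using h.mul_le_add_complementary le_rfl y

theorem complementary_le_mul (h : IsNFunction Φ) {x y : ℝ} (hx : 0 ≤ x) (hy : 0 ≤ y)
    (hxy : y ≤ density Φ x) : complementary Φ y ≤ y * x := by
  calc complementary Φ y ≤ ∫ _ in (0 : ℝ)..y, x :=
        intervalIntegral.integral_mono_on_of_le_Ioo hy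
          h.isSubgradientSelection_inverseDensity.monotone.intervalIntegrable
          intervalIntegrable_const fun r hr => h.inverseDensity_le hx (hr.2.trans_le hxy)
    _ = y * x := by simp

end IsNFunction

theorem isNFunction_rpow (hp : 1 < p) : IsNFunction (fun x => x ^ p) where
  nonneg x hx := Real.rpow_nonneg hx p
  convex := convexOn_rpow hp.le
  tendsto_top := by
    refine (tendsto_rpow_atTop (sub_pos.2 hp)).congr' ?_
    filter_upwards [eventually_gt_atTop 0] with t ht
    exact Real.rpow_sub_one ht.ne' p
  tendsto_zero := by
    have hlim : Tendsto (fun t : ℝ => t ^ (p - 1)) (𝓝[>] 0) (𝓝 (0 ^ (p - 1))) :=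
      (Real.continuousAt_rpow_const 0 (p - 1) (Or.inr (by linarith))).tendsto.mono_left
        nhdsWithin_le_nhds
    rw [Real.zero_rpow (by linarith)] at hlim
    refine hlim.congr' ?_
    filter_upwards [self_mem_nhdsWithin] with t ht
    exact Real.rpow_sub_one (ne_of_gt ht) p
  differentiable := (Real.differentiable_rpow_const hp.le).differentiableOn

section Growth

/-- The `∇₂` condition at infinity, dual to `DeltaTwoInfty`. -/
def NablaTwoInfty (Φ : ℝ → ℝ) : Prop :=
  ∃ l : ℝ, 1 < l ∧ ∃ x₀ : ℝ, 0 ≤ x₀ ∧ ∀ x, x₀ ≤ x → 2 * l * Φ x ≤ Φ (l * x)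

/-- `Φ` grows at infinity at least like the power `p`, uniformly in the starting point `x`; such an
exponent is a lower bound for the lower Matuszewska–Orlicz index of `Φ`. -/
def HasPowerGrowth (Φ : ℝ → ℝ) (p : ℝ) : Prop :=
  ∃ c : ℝ, 0 < c ∧ ∃ x₀ : ℝ, 0 ≤ x₀ ∧ ∀ x r, x₀ ≤ x → 1 ≤ r → c * r ^ p * Φ x ≤ Φ (r * x)

theorem IsNFunction.nablaTwoInfty (h : IsNFunction Φ) (hΔ : DeltaTwoInfty (complementary Φ)) :
    NablaTwoInfty Φ := by
  obtain ⟨K, -, y₀, -, hK⟩ := hΔ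
  obtain ⟨x₀, hy₀, hx₀⟩ :=
    ((h.tendsto_density.eventually_ge_atTop y₀).and (eventually_ge_atTop 0)).exists
  set l := max (K / 2) 2
  have hl : 2 ≤ l := le_max_right _ _
  have hKl : K ≤ 2 * l := by linarith [le_max_left (K / 2) 2]
  refine ⟨l, by linarith, x₀, hx₀, fun x hx => ?_⟩
  have hx0 : 0 ≤ x := hx₀.trans hx
  set y := density Φ x
  have hequality : 2 * l * (Φ x + complementary Φ y) = 2 * l * (x * y) :=
    congrArg (2 * l * ·) (h.add_complementary_density hx0)
  have hYoung : l * x * (2 * y) ≤ Φ (l * x) + complementary Φ (2 * y) :=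
    h.mul_le_add_complementary (by positivity) _
  have hΨ : complementary Φ (2 * y) ≤ 2 * l * complementary Φ y :=
    (hK y (hy₀.trans (h.density_monotoneOn hx₀ hx0 hx))).trans
      (mul_le_mul_of_nonneg_right hKl (h.complementary_nonneg y))
  linarith

theorem pow_mul_le_map_pow_mul {l q x₀ : ℝ} (hl : 1 ≤ l) (hq : 0 ≤ q) (hx₀ : 0 ≤ x₀)
    (hΦ : ∀ x, x₀ ≤ x → q * Φ x ≤ Φ (l * x)) {x : ℝ} (hx : x₀ ≤ x) (n : ℕ) :
    q ^ n * Φ x ≤ Φ (l ^ n * x) := by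
  induction n with
  | zero => simp
  | succ n ih =>
    have hxn : x₀ ≤ l ^ n * x :=
      hx.trans (le_mul_of_one_le_left (hx₀.trans hx) (one_le_pow₀ hl))
    calc q ^ (n + 1) * Φ x = q * (q ^ n * Φ x) := by ring
      _ ≤ q * Φ (l ^ n * x) := by gcongr
      _ ≤ Φ (l * (l ^ n * x)) := hΦ _ hxn
      _ = Φ (l ^ (n + 1) * x) := by ring_nf

theorem IsNFunction.exists_hasPowerGrowth (h : IsNFunction Φ) (hnabla : NablaTwoInfty Φ) :
    ∃ p : ℝ, 1 < p ∧ HasPowerGrowth Φ p := by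
  obtain ⟨l, hl, x₀, hx₀, hg⟩ := hnabla
  have hl0 : 0 < l := by linarith
  set p := Real.logb l (2 * l)
  have hlp : l ^ p = 2 * l := Real.rpow_logb hl0 hl.ne' (by linarith)
  have hp : 1 < p := by
    rw [Real.lt_logb_iff_rpow_lt hl (by linarith), Real.rpow_one]; linarith
  refine ⟨p, hp, (2 * l)⁻¹, by positivity, x₀, hx₀, fun x r hx hr => ?_⟩
  have hx0 : 0 ≤ x := hx₀.trans hx
  obtain ⟨n, hnr, hrn⟩ := exists_nat_pow_near hr hl
  have hrp : (2 * l)⁻¹ * r ^ p ≤ (2 * l) ^ n := by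
    rw [inv_mul_le_iff₀ (by positivity), ← pow_succ']
    calc r ^ p ≤ (l ^ (n + 1)) ^ p := by gcongr
      _ = (2 * l) ^ (n + 1) := by rw [← Real.rpow_pow_comm hl0.le, hlp]
  calc (2 * l)⁻¹ * r ^ p * Φ x ≤ (2 * l) ^ n * Φ x :=
        mul_le_mul_of_nonneg_right hrp (h.nonneg x hx0)
    _ ≤ Φ (l ^ n * x) := pow_mul_le_map_pow_mul hl.le (by positivity) hx₀ hg hx n
    _ ≤ Φ (r * x) := h.monotoneOn (mem_Ici.2 (by positivity)) (mem_Ici.2 (by positivity))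
        (mul_le_mul_of_nonneg_right hnr hx0)

theorem HasPowerGrowth.prec_rpow (hg : HasPowerGrowth Φ p) (hΦ : Tendsto Φ atTop atTop) :
    Prec (fun x => x ^ p) Φ := by
  obtain ⟨c, hc, x₀, -, hg⟩ := hg
  obtain ⟨a, hca, hx₀a, ha⟩ := (((hΦ.const_mul_atTop hc).eventually_ge_atTop 1).and
    ((eventually_ge_atTop x₀).and (eventually_gt_atTop 0))).exists
  refine ⟨a, ha, 1, zero_le_one, fun x hx => ?_⟩
  calc x ^ p ≤ x ^ p * (c * Φ a) := le_mul_of_one_le_right (by positivity) hca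
    _ = c * x ^ p * Φ a := by ring
    _ ≤ Φ (x * a) := hg a x hx₀a hx
    _ = Φ (a * x) := by rw [mul_comm]

theorem HasPowerGrowth.exists_map_inv_mul_le (hg : HasPowerGrowth Φ p) (h : IsNFunction Φ) :
    ∃ C : ℝ, 0 < C ∧ ∃ B : ℝ, 0 ≤ B ∧ ∀ r x, 1 ≤ r → 0 ≤ x →
      Φ (r⁻¹ * x) ≤ C / r ^ p * Φ x + B := by
  obtain ⟨c, hc, x₀, hx₀, hg⟩ := hg
  have hB := h.nonneg x₀ hx₀
  refine ⟨c⁻¹, inv_pos.2 hc, Φ x₀, hB, fun r x hr hx => ?_⟩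
  have hr0 : 0 < r := by linarith
  have hΦx : 0 ≤ c⁻¹ / r ^ p * Φ x := mul_nonneg (by positivity) (h.nonneg x hx)
  rcases le_total x₀ (r⁻¹ * x) with hle | hle
  · have hgrowth := hg _ r hle hr
    rw [mul_inv_cancel_left₀ hr0.ne', ← le_inv_mul_iff₀ (by positivity)] at hgrowth
    calc Φ (r⁻¹ * x) ≤ (c * r ^ p)⁻¹ * Φ x := hgrowth
      _ = c⁻¹ / r ^ p * Φ x := by rw [mul_inv, div_eq_mul_inv]
      _ ≤ _ := le_add_of_nonneg_right hB
  · exact (h.monotoneOn (mem_Ici.2 (by positivity)) hx₀ hle).trans (le_add_of_nonneg_left hΦx)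

end Growth

section Modular

variable {d : ℕ} {T : ℝ} {u v : ℝ → EuclideanSpace ℝ (Fin d)}

instance : IsFiniteMeasure (leb T) :=
  inferInstanceAs (IsFiniteMeasure (volume.restrict (Icc 0 T)))

theorem IsNFunction.aemeasurable_map_norm (h : IsNFunction Φ) (hu : AEMeasurable u (leb T)) :
    AEMeasurable (fun t => Φ ‖u t‖) (leb T) := by
  have hcont : Continuous fun x : ℝ => Φ (max x 0) :=
    h.continuousOn.comp_continuous (by fun_prop) fun x => le_max_right x 0
  simpa [Function.comp_def] using hcont.measurable.comp_aemeasurable hu.norm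

theorem IsNFunction.integral_inner_le_modular_add_one (h : IsNFunction Φ)
    (hu : AEMeasurable u (leb T)) (hu_top : modular T Φ u ≠ ⊤)
    (hv : modular T (complementary Φ) v ≤ 1) :
    ∫ t, inner ℝ (u t) (v t) ∂(leb T) ≤ (modular T Φ u).toReal + 1 := by
  have hYoung (t : ℝ) : ENNReal.ofReal ‖inner ℝ (u t) (v t)‖ ≤
      ENNReal.ofReal (Φ ‖u t‖) + ENNReal.ofReal (complementary Φ ‖v t‖) := by
    rw [← ENNReal.ofReal_add (h.nonneg _ (norm_nonneg _)) (h.complementary_nonneg _)]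
    exact ENNReal.ofReal_le_ofReal
      ((norm_inner_le_norm _ _).trans (h.mul_le_add_complementary (norm_nonneg _) _))
  have hlint : ∫⁻ t, ENNReal.ofReal ‖inner ℝ (u t) (v t)‖ ∂(leb T) ≤ modular T Φ u + 1 :=
    calc _ ≤ ∫⁻ t, (ENNReal.ofReal (Φ ‖u t‖) + ENNReal.ofReal (complementary Φ ‖v t‖)) ∂(leb T) :=
          lintegral_mono hYoung
      _ = modular T Φ u + modular T (complementary Φ) v :=
          lintegral_add_left' (h.aemeasurable_map_norm hu).ennreal_ofReal _
      _ ≤ _ := by gcongr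
  calc ∫ t, inner ℝ (u t) (v t) ∂(leb T)
      ≤ (∫⁻ t, ENNReal.ofReal ‖inner ℝ (u t) (v t)‖ ∂(leb T)).toReal :=
        (le_abs_self _).trans (norm_integral_le_lintegral_norm fun t => inner ℝ (u t) (v t))
    _ ≤ (modular T Φ u + 1).toReal := ENNReal.toReal_mono (by finiteness) hlint
    _ = (modular T Φ u).toReal + 1 := by
        rw [ENNReal.toReal_add hu_top ENNReal.one_ne_top, ENNReal.toReal_one]

theorem IsNFunction.integral_inner_le_orliczNorm (h : IsNFunction Φ)
    (hu : AEMeasurable u (leb T)) (hu_top : modular T Φ u ≠ ⊤)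
    (hv : AEMeasurable v (leb T)) (hv_one : modular T (complementary Φ) v ≤ 1) :
    ∫ t, inner ℝ (u t) (v t) ∂(leb T) ≤ orliczNorm T Φ u := by
  refine le_csSup ⟨(modular T Φ u).toReal + 1, ?_⟩ ⟨v, hv, hv_one, rfl⟩
  rintro x ⟨w, -, hw, rfl⟩
  exact h.integral_inner_le_modular_add_one hu hu_top hw

theorem IsNFunction.orliczNorm_le_mul_modular_add_one (h : IsNFunction Φ) {r : ℝ} (hr : 0 < r)
    (hu : AEMeasurable u (leb T)) (hu_top : modular T Φ (fun t => r⁻¹ • u t) ≠ ⊤) :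
    orliczNorm T Φ u ≤ r * ((modular T Φ fun t => r⁻¹ • u t).toReal + 1) := by
  refine Real.sSup_le ?_ (by positivity)
  rintro x ⟨v, -, hv, rfl⟩
  have hscaled := h.integral_inner_le_modular_add_one (hu.const_smul r⁻¹) hu_top hv
  simp only [Pi.smul_apply, real_inner_smul_left, integral_const_mul] at hscaled
  rwa [inv_mul_le_iff₀ hr] at hscaled

theorem HasPowerGrowth.exists_modular_inv_smul_le (hg : HasPowerGrowth Φ p) (h : IsNFunction Φ)
    (d : ℕ) (T : ℝ) :
    ∃ C : ℝ, 0 < C ∧ ∃ B : ℝ, 0 ≤ B ∧ ∀ r, 1 ≤ r → ∀ u : ℝ → EuclideanSpace ℝ (Fin d),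
      modular T Φ (fun t => r⁻¹ • u t) ≤
        ENNReal.ofReal (C / r ^ p) * modular T Φ u + ENNReal.ofReal B := by
  obtain ⟨C, hC, B, hB, hle⟩ := hg.exists_map_inv_mul_le h
  refine ⟨C, hC, B * (leb T).real univ, by positivity, fun r hr u => ?_⟩
  have : 0 < r := by linarith
  have hCr : 0 ≤ C / r ^ p := by positivity
  have hpointwise (t : ℝ) : ENNReal.ofReal (Φ ‖r⁻¹ • u t‖) ≤
      ENNReal.ofReal (C / r ^ p) * ENNReal.ofReal (Φ ‖u t‖) + ENNReal.ofReal B := by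
    rw [← ENNReal.ofReal_mul hCr,
      ← ENNReal.ofReal_add (mul_nonneg hCr (h.nonneg _ (norm_nonneg _))) hB, norm_smul,
      Real.norm_of_nonneg (by positivity)]
    exact ENNReal.ofReal_le_ofReal (hle r _ hr (norm_nonneg _))
  calc modular T Φ (fun t => r⁻¹ • u t)
      ≤ ∫⁻ t, (ENNReal.ofReal (C / r ^ p) * ENNReal.ofReal (Φ ‖u t‖)
          + ENNReal.ofReal B) ∂(leb T) := lintegral_mono hpointwise
    _ = ENNReal.ofReal (C / r ^ p) * modular T Φ u + ENNReal.ofReal (B * (leb T).real univ) := by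
        rw [lintegral_add_right _ measurable_const, lintegral_const,
          lintegral_const_mul' _ _ ENNReal.ofReal_ne_top, modular, ENNReal.ofReal_mul hB,
          ofReal_measureReal]

theorem HasPowerGrowth.exists_mul_orliczNorm_rpow_le_modular (hg : HasPowerGrowth Φ p)
    (h : IsNFunction Φ) (d : ℕ) (T : ℝ) :
    ∃ b : ℝ, 0 < b ∧ ∃ R : ℝ, 0 < R ∧ ∀ u : ℝ → EuclideanSpace ℝ (Fin d),
      AEMeasurable u (leb T) → R ≤ orliczNorm T Φ u →
        ENNReal.ofReal (b * orliczNorm T Φ u ^ p) ≤ modular T Φ u := by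
  obtain ⟨C, hC, B, hB, hmod⟩ := hg.exists_modular_inv_smul_le h d T
  refine ⟨(C * (B + 2) ^ p)⁻¹, by positivity, B + 2, by positivity, fun u hu hR => ?_⟩
  by_cases htop : modular T Φ u = ⊤
  · simp [htop]
  set N := orliczNorm T Φ u
  set r := N / (B + 2)
  have hr : 1 ≤ r := (one_le_div (by positivity)).2 hR
  have hr0 : 0 < r := by linarith
  have hfin : ENNReal.ofReal (C / r ^ p) * modular T Φ u + ENNReal.ofReal B ≠ ⊤ := by finiteness
  have hscaled : (modular T Φ fun t => r⁻¹ • u t).toReal ≤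
      C / r ^ p * (modular T Φ u).toReal + B := by
    refine (ENNReal.toReal_mono hfin (hmod r hr u)).trans_eq ?_
    rw [ENNReal.toReal_add (by finiteness) (by finiteness), ENNReal.toReal_mul,
      ENNReal.toReal_ofReal (by positivity), ENNReal.toReal_ofReal hB]
  have hnorm : r * (B + 2) ≤ r * ((modular T Φ fun t => r⁻¹ • u t).toReal + 1) :=
    (div_mul_cancel₀ N (by positivity)).trans_le
      (h.orliczNorm_le_mul_modular_add_one hr0 hu (ne_top_of_le_ne_top hfin (hmod r hr u)))
  have hlower : 1 ≤ C / r ^ p * (modular T Φ u).toReal := by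
    linarith [le_of_mul_le_mul_left hnorm hr0]
  rw [ENNReal.ofReal_le_iff_le_toReal htop]
  calc (C * (B + 2) ^ p)⁻¹ * N ^ p = r ^ p / C := by
        rw [Real.div_rpow (by linarith) (by positivity)]; field_simp
    _ ≤ (modular T Φ u).toReal := by
        rw [div_le_iff₀ hC]
        rwa [div_mul_eq_mul_div, one_le_div (by positivity), mul_comm] at hlower

end Modular

section Coercive

variable {d : ℕ} {T k : ℝ}

theorem coercive_iff_forall_exists_mul_le_modular (hk : 0 < k) (hΦ₀ : ∀ᶠ x in atTop, 0 < Φ₀ x) :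
    Coercive d T Φ Φ₀ k ↔ ∀ C : ℝ, 0 < C → ∃ R : ℝ, ∀ u ∈ orliczSpace d T Φ,
      R ≤ orliczNorm T Φ u →
        ENNReal.ofReal (C * Φ₀ (k * orliczNorm T Φ u)) ≤ modular T Φ u := by
  have hbasis := (atTop_basis.comap (orliczNorm (d := d) T Φ)).inf_principal (orliczSpace d T Φ)
  obtain ⟨R₀, hR₀⟩ : ∃ R₀, ∀ N ≥ R₀, 0 < Φ₀ (k * N) :=
    eventually_atTop.1 ((tendsto_id.const_mul_atTop hk).eventually hΦ₀)
  have hratio {C : ℝ} (hC : 0 ≤ C) {u : ℝ → EuclideanSpace ℝ (Fin d)}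
      (hu : R₀ ≤ orliczNorm T Φ u) :
      ENNReal.ofReal C ≤ modular T Φ u / ENNReal.ofReal (Φ₀ (k * orliczNorm T Φ u)) ↔
        ENNReal.ofReal (C * Φ₀ (k * orliczNorm T Φ u)) ≤ modular T Φ u := by
    rw [ENNReal.le_div_iff_mul_le (Or.inl (ENNReal.ofReal_pos.2 (hR₀ _ hu)).ne')
      (Or.inl ENNReal.ofReal_ne_top), ENNReal.ofReal_mul hC]
  rw [Coercive, ENNReal.tendsto_nhds_top_iff_nnreal]
  constructor
  · intro hco C hC
    obtain ⟨R, -, hR⟩ := hbasis.eventually_iff.1 (hco C.toNNReal)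
    refine ⟨max R R₀, fun u hu hRu => ?_⟩
    exact (hratio hC.le ((le_max_right _ _).trans hRu)).1
      (hR ⟨(le_max_left _ _).trans hRu, hu⟩).le
  · intro hmod C
    obtain ⟨R, hR⟩ := hmod (C + 1) (by positivity)
    refine hbasis.eventually_iff.2 ⟨max R R₀, trivial, fun u ⟨hRu, hu⟩ => ?_⟩
    have hRu : max R R₀ ≤ orliczNorm T Φ u := hRu
    refine lt_of_lt_of_le ?_ ((hratio (by positivity) ((le_max_right _ _).trans hRu)).2
      (hR u hu ((le_max_left _ _).trans hRu)))
    rw [← ENNReal.ofReal_coe_nnreal]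
    exact (ENNReal.ofReal_lt_ofReal_iff (by positivity)).2 (lt_add_one _)

theorem HasPowerGrowth.coercive (hg : HasPowerGrowth Φ p) (hp : 0 < p) (h : IsNFunction Φ)
    (hpos : ∀ᶠ x in atTop, 0 < Φ₀ x) (hess : EssPrec Φ₀ fun x => x ^ p) (hk : 0 < k) :
    Coercive d T Φ Φ₀ k := by
  obtain ⟨b, hb, R, hR, hmod⟩ := hg.exists_mul_orliczNorm_rpow_le_modular h d T
  rw [coercive_iff_forall_exists_mul_le_modular hk hpos]
  intro C hC
  set a := (b / C) ^ p⁻¹ / k with ha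
  obtain ⟨y₀, -, hy₀⟩ := hess a (by positivity)
  refine ⟨max R (y₀ / k), fun u hu hRu => ?_⟩
  refine le_trans (ENNReal.ofReal_le_ofReal ?_) (hmod u hu.1 ((le_max_left _ _).trans hRu))
  set N := orliczNorm T Φ u
  have hN : 0 < N := hR.trans_le ((le_max_left _ _).trans hRu)
  have hyN : y₀ ≤ k * N := (div_le_iff₀' hk).1 ((le_max_right _ _).trans hRu)
  calc C * Φ₀ (k * N) ≤ C * (a * (k * N)) ^ p := by gcongr; exact hy₀ _ hyN
    _ = C * ((b / C) ^ p⁻¹ * N) ^ p := by rw [ha, div_mul_eq_mul_div]; field_simp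
    _ = C * (b / C * N ^ p) := by
        rw [Real.mul_rpow (by positivity) hN.le, Real.rpow_inv_rpow (by positivity) hp.ne']
    _ = b * N ^ p := by field_simp

theorem Coercive.exists_mul_orliczNorm_le_modular (hco : Coercive d T Φ Φ₀ k) (hk : 0 < k) {c : ℝ}
    (hc : 0 < c) (hΦ₀ : ∀ᶠ x in atTop, c * x ≤ Φ₀ x) {M : ℝ} (hM : 0 < M) :
    ∃ R : ℝ, 0 < R ∧ ∀ u ∈ orliczSpace d T Φ, R ≤ orliczNorm T Φ u →
      ENNReal.ofReal (M * orliczNorm T Φ u) ≤ modular T Φ u := by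
  have hpos : ∀ᶠ x in atTop, 0 < Φ₀ x := by
    filter_upwards [hΦ₀, eventually_gt_atTop 0] with x hx hx0
    exact (mul_pos hc hx0).trans_le hx
  obtain ⟨R₁, hR₁⟩ := (coercive_iff_forall_exists_mul_le_modular hk hpos).1 hco (M / (c * k))
    (by positivity)
  obtain ⟨R₂, hR₂⟩ : ∃ R₂, ∀ N ≥ R₂, c * (k * N) ≤ Φ₀ (k * N) :=
    eventually_atTop.1 ((tendsto_id.const_mul_atTop hk).eventually hΦ₀)
  refine ⟨max 1 (max R₁ R₂), by positivity, fun u hu hRu => ?_⟩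
  obtain ⟨-, hRu⟩ := max_le_iff.1 hRu
  obtain ⟨hRu₁, hRu₂⟩ := max_le_iff.1 hRu
  refine (ENNReal.ofReal_le_ofReal ?_).trans (hR₁ u hu hRu₁)
  set N := orliczNorm T Φ u
  calc M * N = M / (c * k) * (c * (k * N)) := by field_simp
    _ ≤ M / (c * k) * Φ₀ (k * N) := by gcongr; exact hR₂ N hRu₂

end Coercive

section StepFunction

variable {d : ℕ} {T δ : ℝ}

theorem leb_Icc_zero (hδT : δ ≤ T) : leb T (Icc 0 δ) = ENNReal.ofReal δ := by
  rw [leb, Measure.restrict_apply measurableSet_Icc, inter_eq_left.2 (Icc_subset_Icc_right hδT),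
    Real.volume_Icc, sub_zero]

theorem modular_indicator_Icc {η : ℝ → ℝ} (hη : η 0 = 0) (hδ : 0 ≤ δ) (hδT : δ ≤ T)
    (x : EuclideanSpace ℝ (Fin d)) :
    modular T η ((Icc 0 δ).indicator fun _ => x) = ENNReal.ofReal (δ * η ‖x‖) := by
  have hcomp : (fun t => ENNReal.ofReal (η ‖(Icc 0 δ).indicator (fun _ => x) t‖)) =
      (Icc 0 δ).indicator fun _ => ENNReal.ofReal (η ‖x‖) := by
    ext t
    by_cases ht : t ∈ Icc 0 δ <;> simp [ht, hη]
  rw [modular, hcomp, lintegral_indicator_const measurableSet_Icc, leb_Icc_zero hδT,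
    ENNReal.ofReal_mul hδ, mul_comm]

theorem integral_inner_indicator_Icc (hδ : 0 ≤ δ) (hδT : δ ≤ T)
    (x y : EuclideanSpace ℝ (Fin d)) :
    ∫ t, inner ℝ ((Icc 0 δ).indicator (fun _ => x) t) ((Icc 0 δ).indicator (fun _ => y) t) ∂(leb T)
      = δ * inner ℝ x y := by
  have hcomp : (fun t => inner ℝ ((Icc 0 δ).indicator (fun _ => x) t)
      ((Icc 0 δ).indicator (fun _ => y) t)) = (Icc 0 δ).indicator fun _ => inner ℝ x y := by
    ext t
    by_cases ht : t ∈ Icc 0 δ <;> simp [ht]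
  rw [hcomp, integral_indicator_const _ measurableSet_Icc, measureReal_def, leb_Icc_zero hδT,
    ENNReal.toReal_ofReal hδ, smul_eq_mul]

theorem IsNFunction.indicator_Icc_mem_orliczSpace (h : IsNFunction Φ) (hδ : 0 ≤ δ) (hδT : δ ≤ T)
    (x : EuclideanSpace ℝ (Fin d)) : (Icc 0 δ).indicator (fun _ => x) ∈ orliczSpace d T Φ := by
  refine ⟨(measurable_const.indicator measurableSet_Icc).aemeasurable, 1, one_pos, ?_⟩
  simp only [one_smul]
  rw [modular_indicator_Icc h.map_zero hδ hδT]
  exact ENNReal.ofReal_lt_top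

theorem IsNFunction.mul_inner_le_orliczNorm_indicator_Icc (h : IsNFunction Φ) (hδ : 0 ≤ δ)
    (hδT : δ ≤ T) (x : EuclideanSpace ℝ (Fin d)) {y : EuclideanSpace ℝ (Fin d)}
    (hy : δ * complementary Φ ‖y‖ ≤ 1) :
    δ * inner ℝ x y ≤ orliczNorm T Φ ((Icc 0 δ).indicator fun _ => x) := by
  rw [← integral_inner_indicator_Icc hδ hδT]
  have hmeas (z : EuclideanSpace ℝ (Fin d)) :
      AEMeasurable ((Icc 0 δ).indicator fun _ => z) (leb T) :=
    (measurable_const.indicator measurableSet_Icc).aemeasurable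
  refine h.integral_inner_le_orliczNorm (hmeas x) ?_ (hmeas y) ?_
  · rw [modular_indicator_Icc h.map_zero hδ hδT]
    exact ENNReal.ofReal_ne_top
  · rw [modular_indicator_Icc complementary_zero hδ hδT]
    exact ENNReal.ofReal_le_one.2 hy

theorem IsNFunction.mul_le_map_of_orliczNorm_le_modular (h : IsNFunction Φ) (hd : 0 < d) {M R : ℝ}
    (hM : 0 ≤ M) (hmod : ∀ u ∈ orliczSpace d T Φ,
      R ≤ orliczNorm T Φ u → ENNReal.ofReal (M * orliczNorm T Φ u) ≤ modular T Φ u)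
    {x y : ℝ} (hδ : 0 < δ) (hδT : δ ≤ T) (hx : 0 ≤ x) (hy : 0 ≤ y)
    (hδy : δ * complementary Φ y ≤ 1) (hR : R ≤ δ * (x * y)) :
    M * (x * y) ≤ Φ x := by
  let e : EuclideanSpace ℝ (Fin d) := EuclideanSpace.single ⟨0, hd⟩ 1
  have he : ‖e‖ = 1 := by simp [e]
  have hnorm_smul {z : ℝ} (hz : 0 ≤ z) : ‖z • e‖ = z := by
    rw [norm_smul, he, mul_one, Real.norm_of_nonneg hz]
  have hinner : inner ℝ (x • e) (y • e) = x * y := by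
    rw [real_inner_smul_left, real_inner_smul_right, real_inner_self_eq_norm_sq, he]; ring
  have hnorm := h.mul_inner_le_orliczNorm_indicator_Icc hδ.le hδT (x • e) (y := y • e)
    (by rwa [hnorm_smul hy])
  rw [hinner] at hnorm
  have hmodular := hmod _ (h.indicator_Icc_mem_orliczSpace hδ.le hδT (x • e)) (hR.trans hnorm)
  rw [modular_indicator_Icc h.map_zero hδ.le hδT, hnorm_smul hx,
    ENNReal.ofReal_le_ofReal_iff (mul_nonneg hδ.le (h.nonneg x hx))] at hmodular
  refine le_of_mul_le_mul_left ?_ hδ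
  calc δ * (M * (x * y)) = M * (δ * (x * y)) := by ring
    _ ≤ _ := (mul_le_mul_of_nonneg_left hnorm hM).trans hmodular

theorem IsNFunction.deltaTwoInfty_complementary (h : IsNFunction Φ) (hd : 0 < d) (hT : 0 < T)
    {R : ℝ} (hR : 0 < R) (hmod : ∀ u ∈ orliczSpace d T Φ,
      R ≤ orliczNorm T Φ u → ENNReal.ofReal (2 * orliczNorm T Φ u) ≤ modular T Φ u) :
    DeltaTwoInfty (complementary Φ) := by
  refine ⟨2 * R, by positivity, max 1 (T⁻¹ + Φ 1), by positivity, fun y hy => ?_⟩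
  obtain ⟨hy1, hyT⟩ := max_le_iff.1 hy
  have hy0 : 0 < y := by linarith
  set P := complementary Φ y
  have hTP : T⁻¹ ≤ P := by linarith [h.mul_le_add_complementary zero_le_one y]
  have hP0 : 0 < P := (inv_pos.2 hT).trans_le hTP
  set x := R * P / y
  have hx0 : 0 < x := by positivity
  have hxy : x * y = R * P := div_mul_cancel₀ _ hy0.ne'
  have hΦx : 2 * (x * y) ≤ Φ x :=
    h.mul_le_map_of_orliczNorm_le_modular hd zero_le_two hmod (inv_pos.2 hP0)
      (inv_le_of_inv_le₀ hT hTP) hx0.le hy0.le (inv_mul_cancel₀ hP0.ne').le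
      (by rw [hxy]; field_simp; rfl)
  calc complementary Φ (2 * y) ≤ 2 * y * x :=
        h.complementary_le_mul hx0.le (by positivity) (h.le_density_of_mul_le hx0 (by linarith))
    _ = 2 * R * P := by linarith

end StepFunction

end Orlicz

theorem lemma2_general (d : ℕ) (hd : 0 < d) (T : ℝ) (hT : 0 < T) (Φ : ℝ → ℝ)
    (hΦ : Orlicz.IsNFunction Φ) :
    (Orlicz.DeltaTwoInfty (Orlicz.complementary Φ) →
      ∃ p : ℝ, 1 < p ∧ Orlicz.Prec (fun x => x ^ p) Φ ∧
        ∀ Φ₀ : ℝ → ℝ, (∀ᶠ x in atTop, 0 < Φ₀ x) → Orlicz.EssPrec Φ₀ (fun x => x ^ p) →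
          ∀ k : ℝ, 0 < k → Orlicz.Coercive d T Φ Φ₀ k) ∧
    ((∃ Φ₀ : ℝ → ℝ, (∃ c : ℝ, 0 < c ∧ ∀ᶠ x in atTop, c * x ≤ Φ₀ x) ∧
        ∃ k : ℝ, 0 < k ∧ Orlicz.Coercive d T Φ Φ₀ k) →
      Orlicz.DeltaTwoInfty (Orlicz.complementary Φ)) := by
  refine ⟨fun hΔ => ?_, ?_⟩
  · obtain ⟨p, hp, hgrowth⟩ := hΦ.exists_hasPowerGrowth (hΦ.nablaTwoInfty hΔ)
    exact ⟨p, hp, hgrowth.prec_rpow hΦ.tendsto_atTop, fun Φ₀ hpos hess k hk =>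
      hgrowth.coercive (zero_lt_one.trans hp) hΦ hpos hess hk⟩
  · rintro ⟨Φ₀, ⟨c, hc, hΦ₀⟩, k, hk, hco⟩
    obtain ⟨R, hR, hmod⟩ := hco.exists_mul_orliczNorm_le_modular hk hc hΦ₀ two_pos
    exact hΦ.deltaTwoInfty_complementary hd hT hR hmod

theorem lemma2 (d : ℕ) (hd : 0 < d) (T : ℝ) (hT : 0 < T) (Φ : ℝ → ℝ) (hΦ : Orlicz.IsNFunction Φ) :
    (Orlicz.DeltaTwoInfty (Orlicz.complementary Φ) →
      ∃ Φs : ℝ → ℝ, Orlicz.IsNFunction Φs ∧ Orlicz.Prec Φs Φ ∧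
        ∀ Φ₀ : ℝ → ℝ, Orlicz.IsNFunction Φ₀ → Orlicz.EssPrec Φ₀ Φs →
          ∀ k : ℝ, 0 < k → Orlicz.Coercive d T Φ Φ₀ k) ∧
    ((∃ Φ₀ : ℝ → ℝ, Orlicz.IsNFunction Φ₀ ∧ ∃ k : ℝ, 0 < k ∧ Orlicz.Coercive d T Φ Φ₀ k) →
      Orlicz.DeltaTwoInfty (Orlicz.complementary Φ)) := by
  obtain ⟨hΔ, hco⟩ := lemma2_general d hd T hT Φ hΦ
  refine ⟨fun h => ?_, fun ⟨Φ₀, hΦ₀, hk⟩ => hco ⟨Φ₀, ⟨1, one_pos, hΦ₀.eventually_mul_le 1⟩, hk⟩⟩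
  obtain ⟨p, hp, hprec, hcoercive⟩ := hΔ h
  exact ⟨_, Orlicz.isNFunction_rpow hp, hprec, fun Φ₀ hΦ₀ =>
    hcoercive Φ₀ (hΦ₀.tendsto_atTop.eventually_gt_atTop 0)⟩
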